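/- Let $K$ be a commutative ring with $1$; all rings are associative unital $K$-algebras $R$ (the image of $K$ is central). For a subset $S\subseteq R$, let $R\langle X_S\rangle$ be the $K$-algebra freely generated by $R$ and noncommuting indeterminates $x_s$ $(s\in S)$, and let $R\langle S^{-1}\rangle$ be its factor ring by the ideal generated by all $sx_s-1$ and $x_ss-1$, $s\in S$. The set $S$ is called *localizable* if $R\langle S^{-1}\rangle\neq 0$; let $\mathrm{L}(R)$ be the set of localizable subsets of $R$. A set $S\subseteq R$ is *multiplicative* if $SS\subseteq S$, $1\in S$, $0\notin S$. A multiplicative set $S$ is a *left Ore set* if $Sr\cap Rs\neq\emptyset$ for all $r\in R$, $s\in S$; a left Ore set is a *left denominator set* if $rs=0$ with $r\in R$, $s\in S$ implies $tr=0$ for some $t\in S$; right Ore and right denominator sets are defined symmetrically, and *Ore* (*denominator*) sets are those that are both left and right Ore (denominator) sets. Let $\mathrm{Ore}_l(R),\mathrm{Ore}_r(R),\mathrm{Ore}(R)$ be the sets of left, right and two-sided Ore sets of $R$, and $\mathrm{Den}_l(R),\mathrm{Den}(R)$ the sets of left and two-sided denominator sets. For a family $\mathcal{F}$ of subsets of $R$,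 $\max\mathcal{F}$ is the set of its maximal elements with respect to inclusion. Let $\mathcal{C}_R$ be the set of regular elements (non-zero-divisors) of $R$, $\min(R)$ the set of minimal prime ideals of $R$, and for $\mathfrak{p}\in\min(R)$ let $\mathcal{C}(\mathfrak{p})=\{c\in R\mid c+\mathfrak{p}\in\mathcal{C}_{R/\mathfrak{p}}\}$. 1. If $R$ is a semiprime left Goldie ring, then $$\{\mathcal{S}\in\max\mathrm{L}(R)\mid \mathcal{C}_R\subseteq\mathcal{S}\}=\max\mathrm{Den}_l(R)=\{\mathcal{C}(\mathfrak{p})\mid\mathfrak{p}\in\min(R)\}.$$ 2. If $R$ is a semiprime (left and right) Goldie ring, then $$\{\mathcal{S}\in\max\mathrm{L}(R)\mid \mathcal{C}_R\subseteq\mathcal{S}\}=\max\mathrm{Ore}(R)=\max\mathrm{Den}(R)=\{\mathcal{C}(\mathfrak{p})\mid\mathfrak{p}\in\min(R)\}=\mathcal{N}_l=\mathcal{N}_r=\mathcal{N},$$ where $\mathcal{N}_l$, $\mathcal{N}_r$, $\mathcal{N}$ denote the sets of those maximal elements $S$ of $\mathrm{L}(R)\cap\mathrm{Ore}_l(R)$,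 of $\mathrm{L}(R)\cap\mathrm{Ore}_r(R)$ and of $\mathrm{L}(R)\cap\mathrm{Ore}(R)$, respectively, that satisfy $\mathcal{C}_R\subseteq S$. -/

import Mathlib

namespace SetLoc

universe u v

/-! ### Semiprime rings, Goldie rings, prime ideals, regular elements -/

/-- A ring is semiprime if `a R a = 0` implies `a = 0`. -/
def IsSemiprimeRing (R : Type v) [Ring R] : Prop :=
  ∀ a : R, (∀ r : R, a * r * a = 0) → a = 0

/-- The left annihilator `{r | r x = 0 for all x ∈ X}` of a subset `X`, a left ideal. -/
def leftAnn {R : Type v} [Ring R] (X : Set R) : Ideal R where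
  carrier := {r | ∀ x ∈ X, r * x = 0}
  add_mem' := by
    intro a b ha hb x hx
    rw [add_mul, ha x hx, hb x hx, add_zero]
  zero_mem' := by
    intro x _
    exact zero_mul x
  smul_mem' := by
    intro c a ha x hx
    rw [smul_eq_mul, mul_assoc, ha x hx, mul_zero]

/-- A ring is left Goldie if it contains no infinite direct sum of nonzero left ideals and
satisfies the ascending chain condition on left annihilators. (`Ideal R` is the type of left
ideals of `R`.) -/
structure IsLeftGoldie (R : Type v) [Ring R] : Prop where
  no_infinite_direct_sum : ¬ ∃ I : ℕ → Ideal R, (∀ n, I n ≠ ⊥) ∧ iSupIndep I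
  acc_leftAnn : ∀ X : ℕ → Set R, Monotone (fun n => leftAnn (X n)) →
    ∃ n, ∀ m, n ≤ m → leftAnn (X m) = leftAnn (X n)

/-- A ring is right Goldie if its opposite ring is left Goldie. -/
def IsRightGoldie (R : Type v) [Ring R] : Prop :=
  IsLeftGoldie Rᵐᵒᵖ

/-- A ring is Goldie if it is left and right Goldie. -/
def IsGoldie (R : Type v) [Ring R] : Prop :=
  IsLeftGoldie R ∧ IsRightGoldie R

/-- A proper two-sided ideal `p` is prime if `a R b ⊆ p` implies `a ∈ p` or `b ∈ p`. -/
def IsPrimeIdeal {R : Type v} [Ring R] (p : TwoSidedIdeal R) : Prop :=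
  p ≠ ⊤ ∧ ∀ a b : R, (∀ r : R, a * r * b ∈ p) → a ∈ p ∨ b ∈ p

/-- `min(R)`: the set of minimal prime ideals of `R`. -/
def minPrimes (R : Type v) [Ring R] : Set (TwoSidedIdeal R) :=
  {p | Minimal IsPrimeIdeal p}

/-- `𝒞_R`: the set of regular elements (two-sided non-zero-divisors) of `R`. -/
def regularElements (R : Type v) [Ring R] : Set R :=
  {c | IsRegular c}

/-- `𝒞(p)`: the elements of `R` whose image in `R/p` is regular. -/
def regularModulo {R : Type v} [Ring R] (p : TwoSidedIdeal R) : Set R :=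
  {c | (c : p.ringCon.Quotient) ∈ regularElements p.ringCon.Quotient}

/-! ### Ore sets and denominator sets -/

/-- A multiplicative set: `S S ⊆ S`, `1 ∈ S` and `0 ∉ S`. -/
structure IsMultiplicativeSet {R : Type v} [Ring R] (S : Set R) : Prop where
  mul_mem : ∀ a ∈ S, ∀ b ∈ S, a * b ∈ S
  one_mem : (1 : R) ∈ S
  zero_notMem : (0 : R) ∉ S

/-- A left Ore set: a multiplicative set with `S r ∩ R s ≠ ∅` for all `r ∈ R`, `s ∈ S`. -/
structure IsLeftOreSet {R : Type v} [Ring R] (S : Set R) : Prop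
    extends IsMultiplicativeSet S where
  left_ore : ∀ r : R, ∀ s ∈ S, ∃ s' ∈ S, ∃ r' : R, s' * r = r' * s

/-- A right Ore set: a multiplicative set with `r S ∩ s R ≠ ∅` for all `r ∈ R`, `s ∈ S`. -/
structure IsRightOreSet {R : Type v} [Ring R] (S : Set R) : Prop
    extends IsMultiplicativeSet S where
  right_ore : ∀ r : R, ∀ s ∈ S, ∃ s' ∈ S, ∃ r' : R, r * s' = s * r'

/-- A left denominator set: a left Ore set such that `r s = 0` with `s ∈ S` implies `t r = 0`
for some `t ∈ S`. -/
structure IsLeftDenominatorSet {R : Type v} [Ring R] (S : Set R) : Prop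
    extends IsLeftOreSet S where
  left_cancel : ∀ r : R, ∀ s ∈ S, r * s = 0 → ∃ t ∈ S, t * r = 0

/-- A right denominator set: a right Ore set such that `s r = 0` with `s ∈ S` implies `r t = 0`
for some `t ∈ S`. -/
structure IsRightDenominatorSet {R : Type v} [Ring R] (S : Set R) : Prop
    extends IsRightOreSet S where
  right_cancel : ∀ r : R, ∀ s ∈ S, s * r = 0 → ∃ t ∈ S, r * t = 0

/-- An Ore set is a left and right Ore set. -/
def IsOreSet {R : Type v} [Ring R] (S : Set R) : Prop :=
  IsLeftOreSet S ∧ IsRightOreSet S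

/-- A denominator set is a left and right denominator set. -/
def IsDenominatorSet {R : Type v} [Ring R] (S : Set R) : Prop :=
  IsLeftDenominatorSet S ∧ IsRightDenominatorSet S

/-! ### The localization `R⟨S⁻¹⟩` of a `K`-algebra at an arbitrary subset, localizable sets -/

section Localization

variable (K : Type u) {R : Type v} [CommRing K] [Ring R] [Algebra K R] (S : Set R)

/-- The relations that turn the free `K`-algebra on the disjoint union of `R` and `{x_s | s ∈ S}`
into the `K`-algebra `R⟨X_S⟩` freely generated by the `K`-algebra `R` and the noncommuting
indeterminates `x_s`: they make `R → R⟨X_S⟩` a homomorphism of `K`-algebras. -/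
inductive FreeExtRel : FreeAlgebra K (R ⊕ S) → FreeAlgebra K (R ⊕ S) → Prop
  | add (a b : R) : FreeExtRel (FreeAlgebra.ι K (Sum.inl (a + b)))
      (FreeAlgebra.ι K (Sum.inl a) + FreeAlgebra.ι K (Sum.inl b))
  | mul (a b : R) : FreeExtRel (FreeAlgebra.ι K (Sum.inl (a * b)))
      (FreeAlgebra.ι K (Sum.inl a) * FreeAlgebra.ι K (Sum.inl b))
  | scalar (k : K) : FreeExtRel (FreeAlgebra.ι K (Sum.inl (algebraMap K R k)))
      (algebraMap K (FreeAlgebra K (R ⊕ S)) k)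

/-- `R⟨X_S⟩`: the `K`-algebra freely generated by `R` and the indeterminates `x_s`, `s ∈ S`. -/
abbrev FreeExt : Type (max u v) :=
  RingQuot (FreeExtRel K S)

/-- The canonical map `R → R⟨X_S⟩`. -/
noncomputable def FreeExt.of (r : R) : FreeExt K S :=
  RingQuot.mkAlgHom K (FreeExtRel K S) (FreeAlgebra.ι K (Sum.inl r))

/-- The indeterminate `x_s` of `R⟨X_S⟩`. -/
noncomputable def FreeExt.x (s : S) : FreeExt K S :=
  RingQuot.mkAlgHom K (FreeExtRel K S) (FreeAlgebra.ι K (Sum.inr s))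

/-- The relations `s x_s = 1` and `x_s s = 1`, `s ∈ S`. -/
inductive InvRel : FreeExt K S → FreeExt K S → Prop
  | right_inv (s : S) : InvRel (FreeExt.of K S (s : R) * FreeExt.x K S s) 1
  | left_inv (s : S) : InvRel (FreeExt.x K S s * FreeExt.of K S (s : R)) 1

/-- `R⟨S⁻¹⟩`: the factor ring of `R⟨X_S⟩` by the ideal generated by all
`s x_s - 1` and `x_s s - 1`, `s ∈ S`. -/
abbrev SetLocalization : Type (max u v) :=
  RingQuot (InvRel K S)

/-- `S` is a localizable set of the `K`-algebra `R` if `R⟨S⁻¹⟩ ≠ 0`. -/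
def IsLocalizable : Prop :=
  Nontrivial (SetLocalization K S)

end Localization

end SetLoc

/-!
A minimal prime `p` of a semiprime left Goldie ring is an annihilator ideal: it is the annihilator
of a cyclic left module `Ry` all of whose nonzero submodules have the same annihilator. The sum of
an annihilator ideal `p` and its left annihilator is essential as a left ideal, hence by Goldie's
theorem contains a regular element `d + e`, where `d * p = 0` and `e ∈ p`. Then `s ↦ d * s + e`
lifts elements that are regular modulo `p` to regular elements of `R`, which transfers Goldie's left
Ore condition from the regular elements of `R` to `𝒞(p)` without passing to the ring `R/p`.

Conversely, suppose that a ring homomorphism inverts `S` and kills no regular element. Its kernel is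
then not essential, so it is disjoint from some `Ry` as above. Hence the kernel annihilates `Ry`,
and `S ⊆ 𝒞(p)` for the minimal prime `p` that annihilates `Ry`. This applies to `R → R⟨S⁻¹⟩` if `S`
is localizable and contains the regular elements, and to the Ore localization if `S` is a left
denominator set; every left Ore set of `R` is one, by the chain condition on annihilators. The
right-handed conditions on `𝒞(p)` follow by passing to the opposite ring, as being an annihilator
ideal is a left-right symmetric notion in a semiprime ring.
-/

namespace SetLoc

universe u v

section Goldie

variable {R : Type v} [Ring R]

lemma mem_leftAnn {X : Set R} {r : R} : r ∈ leftAnn X ↔ ∀ x ∈ X, r * x = 0 := Iff.rfl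

lemma mem_leftAnn_singleton {x r : R} : r ∈ leftAnn {x} ↔ r * x = 0 := by
  simp only [mem_leftAnn, Set.mem_singleton_iff, forall_eq]

lemma leftAnn_singleton_le_mul (x y : R) : leftAnn {x} ≤ leftAnn {x * y} := by
  intro r hr
  rw [mem_leftAnn_singleton] at hr ⊢
  rw [← mul_assoc, hr, zero_mul]

lemma iSupIndep_of_le_of_disjoint {ι M : Type*} [LinearOrder ι] [AddCommGroup M] [Module R M]
    {I J : ι → Submodule R M} (hle : ∀ ⦃i j⦄, i < j → I j ≤ J i)
    (hdisj : ∀ i, Disjoint (I i) (J i)) : iSupIndep I := by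
  rw [iSupIndep_iff_finsetSum_eq_zero_imp_eq_zero]
  intro s
  induction s using Finset.induction_on_min with
  | empty => simp
  | insert i s hi ih =>
    intro v hv hsum
    have his : i ∉ s := fun h => lt_irrefl i (hi i h)
    rw [Finset.sum_insert his] at hsum
    have hvi : v i = 0 := by
      refine Submodule.disjoint_def.1 (hdisj i) _ (hv i (Finset.mem_insert_self i s)) ?_
      rw [eq_neg_of_add_eq_zero_left hsum]
      exact neg_mem (sum_mem fun j hj => hle (hi j hj) (hv j (Finset.mem_insert_of_mem hj)))
    rw [hvi, zero_add] at hsum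
    have hvs := ih v (fun j hj => hv j (Finset.mem_insert_of_mem hj)) hsum
    simpa only [Finset.forall_mem_insert, hvi, true_and] using hvs

lemma IsLeftGoldie.exists_eq_bot (hG : IsLeftGoldie R) {I : ℕ → Ideal R} (hI : iSupIndep I) :
    ∃ n, I n = ⊥ := by
  by_contra! h
  exact hG.no_infinite_direct_sum ⟨I, h, hI⟩

lemma IsLeftGoldie.exists_maximalFor_leftAnn (hG : IsLeftGoldie R) {α : Type*} (f : α → Set R)
    {P : α → Prop} (hP : ∃ a, P a) : ∃ a, MaximalFor P (fun a => leftAnn (f a)) a := by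
  have : WellFoundedGT (Set.range (leftAnn : Set R → Ideal R)) := by
    rw [wellFoundedGT_iff_monotone_chain_condition]
    intro g
    choose X hX using fun n => (g n).2
    obtain ⟨n, hn⟩ := hG.acc_leftAnn X fun i j hij => by
      simp only [hX]
      exact g.monotone hij
    exact ⟨n, fun m hm => Subtype.ext (by rw [← hX, ← hX, hn m hm])⟩
  exact exists_maximalFor_of_wellFoundedGT P (fun a => Set.rangeFactorization leftAnn (f a)) hP

/-- A left ideal is essential if it meets every nonzero left ideal nontrivially; it suffices to
test the principal ones. -/
def IsEssential (E : Ideal R) : Prop :=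
  ∀ y : R, y ≠ 0 → ∃ t, t * y ≠ 0 ∧ t * y ∈ E

lemma IsEssential.mono {E F : Ideal R} (hE : IsEssential E) (h : E ≤ F) : IsEssential F :=
  fun y hy => (hE y hy).imp fun _ ht => ⟨ht.1, h ht.2⟩

lemma IsEssential.residual {E F : Ideal R} (hE : IsEssential E) {r : R}
    (hF : ∀ x, x * r ∈ E → x ∈ F) : IsEssential F := by
  intro y hy
  by_cases h : y * r = 0
  · exact ⟨1, by rwa [one_mul], hF _ (by rw [one_mul, h]; exact E.zero_mem)⟩
  · obtain ⟨t, ht, htE⟩ := hE _ h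
    rw [← mul_assoc] at ht htE
    exact ⟨t, left_ne_zero_of_mul ht, hF _ htE⟩

/-- The elements `a` with `Ra ∩ leftAnn {a} = 0`, equivalently `leftAnn {a²} = leftAnn {a}`. They
are the building blocks of regular elements. -/
def IsAnnStable (a : R) : Prop :=
  ∀ r, r * a * a = 0 → r * a = 0

lemma IsAnnStable.disjoint {a : R} (ha : IsAnnStable a) :
    Disjoint (Ideal.span {a}) (leftAnn {a}) := by
  rw [Submodule.disjoint_def]
  intro x hx hxa
  obtain ⟨r, rfl⟩ := Ideal.mem_span_singleton'.1 hx
  exact ha r (mem_leftAnn_singleton.1 hxa)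

lemma IsAnnStable.mul_eq_zero_of_mul_add_eq_zero {a c r : R} (hc : IsAnnStable c)
    (hac : a * c = 0) (h : r * (c + a) = 0) : r * c = 0 ∧ r * a = 0 := by
  have hrc : r * c = 0 := hc r <| by
    simpa only [mul_add, add_mul, mul_assoc, hac, mul_zero, add_zero, zero_mul]
      using congrArg (· * c) h
  exact ⟨hrc, by rwa [mul_add, hrc, zero_add] at h⟩

lemma IsAnnStable.add {a c : R} (hc : IsAnnStable c) (ha : IsAnnStable a) (hac : a * c = 0) :
    IsAnnStable (c + a) := by
  intro r h
  obtain ⟨hsc, hsa⟩ := hc.mul_eq_zero_of_mul_add_eq_zero hac h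
  have hrc : r * c = 0 := hc r (by simpa only [mul_add, add_mul, mul_assoc, hac, mul_zero,
    add_zero] using hsc)
  have hra : r * a = 0 := ha r (by simpa only [mul_add, add_mul, hrc, zero_mul, zero_add] using hsa)
  rw [mul_add, hrc, hra, add_zero]

lemma exists_isAnnStable_mem (hR : IsSemiprimeRing R) (hG : IsLeftGoldie R) {I : Ideal R}
    (hI : I ≠ ⊥) : ∃ a ∈ I, a ≠ 0 ∧ IsAnnStable a := by
  obtain ⟨z, ⟨hzI, hz0⟩, hmax⟩ := hG.exists_maximalFor_leftAnn (fun x : R => {x})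
    (Submodule.exists_mem_ne_zero_of_ne_bot hI)
  obtain ⟨r, hr⟩ : ∃ r, z * r * z ≠ 0 := by
    by_contra! h
    exact hz0 (hR z h)
  refine ⟨r * z, I.mul_mem_left _ hzI, fun h => hr (by rw [mul_assoc, h, mul_zero]), ?_⟩
  intro t ht
  have hle : leftAnn {z} ≤ leftAnn {z * r * z} := by
    simpa only [mul_assoc] using leftAnn_singleton_le_mul z (r * z)
  have htr : t * r ∈ leftAnn {z * r * z} :=
    mem_leftAnn_singleton.2 (by simpa only [mul_assoc] using ht)
  rw [← mul_assoc]
  exact mem_leftAnn_singleton.1 (hmax ⟨I.mul_mem_left _ hzI, hr⟩ hle htr)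

/- If `x ≠ 0` then some `a = s * x ≠ 0` is stable, but `leftAnn {a}` is essential, so it meets
`Ra`. -/
lemma eq_zero_of_isEssential_leftAnn (hR : IsSemiprimeRing R) (hG : IsLeftGoldie R) {x : R}
    (hx : IsEssential (leftAnn {x})) : x = 0 := by
  by_contra hx0
  obtain ⟨a, hax, ha0, ha⟩ := exists_isAnnStable_mem hR hG (I := Ideal.span {x})
    (by rwa [Ne, Ideal.span_singleton_eq_bot])
  obtain ⟨s, rfl⟩ := Ideal.mem_span_singleton'.1 hax
  have hess : IsEssential (leftAnn {s * x}) := hx.residual (r := s) fun r hr => by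
    rwa [mem_leftAnn_singleton, mul_assoc, ← mem_leftAnn_singleton] at hr
  obtain ⟨t, ht0, ht⟩ := hess _ ha0
  exact ht0 (ha t (mem_leftAnn_singleton.1 ht))

lemma IsEssential.eq_zero_of_mul_eq_zero (hR : IsSemiprimeRing R) (hG : IsLeftGoldie R)
    {E : Ideal R} (hE : IsEssential E) {x : R} (h : ∀ e ∈ E, e * x = 0) : x = 0 :=
  eq_zero_of_isEssential_leftAnn hR hG (hE.mono fun e he => mem_leftAnn_singleton.2 (h e he))

lemma isEssential_span_singleton (hG : IsLeftGoldie R) {c : R} (hc : IsRightRegular c) :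
    IsEssential (Ideal.span {c}) := by
  intro y hy
  by_contra! h
  have hle : ∀ ⦃n m : ℕ⦄, n < m → Ideal.span {y * c ^ m} ≤ Ideal.span {c ^ (n + 1)} := by
    intro n m hnm
    rw [Ideal.span_singleton_le_iff_mem, Ideal.mem_span_singleton']
    exact ⟨y * c ^ (m - (n + 1)), by rw [mul_assoc, ← pow_add, Nat.sub_add_cancel hnm]⟩
  have hdisj : ∀ n : ℕ, Disjoint (Ideal.span {y * c ^ n}) (Ideal.span {c ^ (n + 1)}) := by
    intro n
    rw [Submodule.disjoint_def]
    intro x hx hx'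
    obtain ⟨t, rfl⟩ := Ideal.mem_span_singleton'.1 hx
    obtain ⟨s, hs⟩ := Ideal.mem_span_singleton'.1 hx'
    have hts : s * c = t * y := (hc.pow n) (by simpa only [mul_assoc, ← pow_succ'] using hs)
    have hty : t * y = 0 := by
      by_contra h0
      exact h t h0 (Ideal.mem_span_singleton'.2 ⟨s, hts⟩)
    rw [← mul_assoc, hty, zero_mul]
  obtain ⟨n, hn⟩ := hG.exists_eq_bot (iSupIndep_of_le_of_disjoint hle hdisj)
  rw [Ideal.span_singleton_eq_bot] at hn
  exact hy (hc.pow n (by simpa only [zero_mul] using hn))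

lemma mem_regularElements_iff (hR : IsSemiprimeRing R) (hG : IsLeftGoldie R) {c : R} :
    c ∈ regularElements R ↔ ∀ r, r * c = 0 → r = 0 := by
  rw [← isRightRegular_iff_left_eq_zero_of_mul]
  refine ⟨fun h => h.right, fun hc => ⟨isLeftRegular_iff_right_eq_zero_of_mul.2 fun x hx => ?_, hc⟩⟩
  refine (isEssential_span_singleton hG hc).eq_zero_of_mul_eq_zero hR hG fun e he => ?_
  obtain ⟨s, rfl⟩ := Ideal.mem_span_singleton'.1 he
  rw [mul_assoc, hx, mul_zero]

lemma IsEssential.exists_isAnnStable_mul_eq_zero (hR : IsSemiprimeRing R) (hG : IsLeftGoldie R)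
    {E : Ideal R} (hE : IsEssential E) {c : R} (hc : c ∉ regularElements R) :
    ∃ a ∈ E, a ≠ 0 ∧ a * c = 0 ∧ IsAnnStable a := by
  obtain ⟨y, hyc, hy0⟩ : ∃ y, y * c = 0 ∧ y ≠ 0 := by
    simpa only [mem_regularElements_iff hR hG, not_forall, exists_prop] using hc
  obtain ⟨t, ht0, htE⟩ := hE y hy0
  have htc : t * y ∈ leftAnn {c} := Ideal.mul_mem_left _ t (mem_leftAnn_singleton.2 hyc)
  obtain ⟨a, ⟨haE, hac⟩, ha0, ha⟩ := exists_isAnnStable_mem hR hG (I := E ⊓ leftAnn {c})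
    ((Submodule.ne_bot_iff _).2 ⟨t * y, ⟨htE, htc⟩, ht0⟩)
  exact ⟨a, haE, ha0, mem_leftAnn_singleton.1 hac, ha⟩

/- As long as `c ∈ E` is not regular, it can be enlarged to `c + a` with `0 ≠ a ∈ E` killing `c`;
repeating this forever would produce an infinite direct sum of the left ideals `Ra`. -/
theorem IsEssential.exists_regular (hR : IsSemiprimeRing R) (hG : IsLeftGoldie R) {E : Ideal R}
    (hE : IsEssential E) : ∃ c ∈ E, c ∈ regularElements R := by
  by_contra! hno
  choose! a haE ha0 hac ha using fun c (hc : c ∈ E) =>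
    hE.exists_isAnnStable_mul_eq_zero hR hG (hno c hc)
  let c : ℕ → R := fun n => (fun c => c + a c)^[n] 0
  have c_succ (n : ℕ) : c (n + 1) = c n + a (c n) := Function.iterate_succ_apply' ..
  have hcE (n : ℕ) : c n ∈ E ∧ IsAnnStable (c n) := by
    induction n with
    | zero => exact ⟨E.zero_mem, fun r _ => mul_zero r⟩
    | succ n ih =>
      rw [c_succ]
      exact ⟨E.add_mem ih.1 (haE _ ih.1), ih.2.add (ha _ ih.1) (hac _ ih.1)⟩
  have hsucc (n : ℕ) : leftAnn {c (n + 1)} ≤ leftAnn {c n} ⊓ leftAnn {a (c n)} := by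
    intro r hr
    rw [mem_leftAnn_singleton, c_succ] at hr
    simpa only [Submodule.mem_inf, mem_leftAnn_singleton] using
      (hcE n).2.mul_eq_zero_of_mul_add_eq_zero (hac _ (hcE n).1) hr
  have hanti : Antitone fun n => leftAnn {c n} :=
    antitone_nat_of_succ_le fun n => (hsucc n).trans inf_le_left
  have hindep : iSupIndep fun n => Ideal.span {a (c n)} := by
    refine iSupIndep_of_le_of_disjoint (J := fun n => leftAnn {a (c n)}) (fun n m hnm => ?_)
      fun n => (ha _ (hcE n).1).disjoint
    rw [Ideal.span_singleton_le_iff_mem]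
    exact ((hanti hnm).trans ((hsucc n).trans inf_le_right))
      (mem_leftAnn_singleton.2 (hac _ (hcE m).1))
  obtain ⟨n, hn⟩ := hG.exists_eq_bot hindep
  exact ha0 _ (hcE n).1 (Ideal.span_singleton_eq_bot.1 hn)

theorem exists_regular_mul_eq (hR : IsSemiprimeRing R) (hG : IsLeftGoldie R) (r : R) {c : R}
    (hc : c ∈ regularElements R) : ∃ c' ∈ regularElements R, ∃ r', c' * r = r' * c := by
  have hess : IsEssential (Submodule.comap (LinearMap.toSpanSingleton R R r)
      (Ideal.span {c})) :=
    (isEssential_span_singleton hG hc.right).residual (r := r) fun x hx => hx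
  obtain ⟨c', hc', hreg⟩ := hess.exists_regular hR hG
  obtain ⟨r', hr'⟩ := Ideal.mem_span_singleton'.1 hc'
  exact ⟨c', hreg, r', hr'.symm⟩

end Goldie

section AnnihilatorIdeals

variable {R : Type v} [Ring R]

lemma IsSemiprimeRing.mul_mul_eq_zero_swap (hR : IsSemiprimeRing R) {a b : R}
    (h : ∀ t, a * t * b = 0) (t : R) : b * t * a = 0 := by
  refine hR _ fun s => ?_
  calc b * t * a * s * (b * t * a) = b * t * (a * s * b) * (t * a) := by noncomm_ring
    _ = 0 := by rw [h, mul_zero, zero_mul]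

lemma coe_quotient_eq_zero {p : TwoSidedIdeal R} {x : R} :
    (x : p.ringCon.Quotient) = 0 ↔ x ∈ p := by
  rw [TwoSidedIdeal.mem_iff, ← RingCon.eq, RingCon.coe_zero]

lemma mem_regularModulo_iff {p : TwoSidedIdeal R} {c : R} :
    c ∈ regularModulo p ↔ (∀ x, c * x ∈ p → x ∈ p) ∧ ∀ x, x * c ∈ p → x ∈ p := by
  simp only [regularModulo, regularElements, Set.mem_ofPred_eq, isRegular_iff,
    isLeftRegular_iff_right_eq_zero_of_mul, isRightRegular_iff_left_eq_zero_of_mul,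
    (RingCon.mk'_surjective p.ringCon).forall, RingCon.coe_mk', ← RingCon.coe_mul,
    coe_quotient_eq_zero]

/-- A two-sided ideal is an annihilator ideal if it is the right annihilator of its left
annihilator. -/
def IsAnnihilator (p : TwoSidedIdeal R) : Prop :=
  ∀ x : R, (∀ u ∈ leftAnn (p : Set R), u * x = 0) → x ∈ p

lemma mul_mem_leftAnn {p : TwoSidedIdeal R} {u : R} (hu : u ∈ leftAnn (p : Set R)) (r : R) :
    u * r ∈ leftAnn (p : Set R) := fun x hx => by
  rw [mul_assoc, hu _ (p.mul_mem_left r x hx)]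

lemma mul_eq_zero_of_mem_of_mem_leftAnn (hR : IsSemiprimeRing R) {p : TwoSidedIdeal R} {x u : R}
    (hx : x ∈ p) (hu : u ∈ leftAnn (p : Set R)) : x * u = 0 := by
  simpa only [mul_one] using
    hR.mul_mul_eq_zero_swap (fun t => (mul_mem_leftAnn hu t) x hx) 1

namespace IsAnnihilator

variable {p : TwoSidedIdeal R}

lemma mem_of_forall_mul_eq_zero (hp : IsAnnihilator p) (hR : IsSemiprimeRing R) {x : R}
    (h : ∀ u ∈ leftAnn (p : Set R), x * u = 0) : x ∈ p :=
  hp x fun u hu => by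
    simpa only [mul_one] using hR.mul_mul_eq_zero_swap
      (fun t => by rw [mul_assoc, h _ (Ideal.mul_mem_left _ t hu)]) 1

lemma isEssential_leftAnn_sup (hp : IsAnnihilator p) :
    IsEssential (leftAnn (p : Set R) ⊔ TwoSidedIdeal.asIdeal p) := by
  intro y hy
  by_cases hyp : y ∈ p
  · exact ⟨1, by rwa [one_mul], Submodule.mem_sup_right (Ideal.mul_mem_left _ 1 hyp)⟩
  · obtain ⟨u, hu, huy⟩ : ∃ u ∈ leftAnn (p : Set R), u * y ≠ 0 := by
      by_contra! h
      exact hyp (hp y h)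
    exact ⟨u, huy, Submodule.mem_sup_left (mul_mem_leftAnn hu y)⟩

lemma exists_add_mem_regularElements (hp : IsAnnihilator p) (hR : IsSemiprimeRing R)
    (hG : IsLeftGoldie R) :
    ∃ d ∈ leftAnn (p : Set R), ∃ e ∈ p, d + e ∈ regularElements R := by
  obtain ⟨c, hc, hreg⟩ := hp.isEssential_leftAnn_sup.exists_regular hR hG
  obtain ⟨d, hd, e, he, rfl⟩ := Submodule.mem_sup.1 hc
  exact ⟨d, hd, e, he, hreg⟩

lemma mem_of_mul_mem (hp : IsAnnihilator p) {d e : R} (he : e ∈ p)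
    (hde : d + e ∈ regularElements R) {x : R} (hx : x * d ∈ p) : x ∈ p := by
  refine hp x fun u hu => hde.right.mul_right_eq_zero_iff.1 ?_
  rw [mul_add, mul_assoc, mul_assoc, hu _ hx, hu _ (p.mul_mem_left x e he), add_zero]

lemma mul_add_mem_regularElements (hp : IsAnnihilator p) (hR : IsSemiprimeRing R)
    (hG : IsLeftGoldie R) {d e s : R} (hd : d ∈ leftAnn (p : Set R)) (he : e ∈ p)
    (hde : d + e ∈ regularElements R) (hs : ∀ x, x * s ∈ p → x ∈ p) :
    d * s + e ∈ regularElements R := by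
  rw [mem_regularElements_iff hR hG]
  intro x hx
  rw [mul_add, ← mul_assoc] at hx
  have hxp : x ∈ p := by
    refine hp.mem_of_mul_mem he hde (hs _ ?_)
    rw [eq_neg_of_add_eq_zero_left hx]
    exact p.neg_mem (p.mul_mem_left x e he)
  have hxd : x * d = 0 := mul_eq_zero_of_mem_of_mem_leftAnn hR hxp hd
  rw [hxd, zero_mul, zero_add] at hx
  exact hde.right.mul_right_eq_zero_iff.1 (by rw [mul_add, hxd, hx, add_zero])

theorem mem_regularModulo_iff (hp : IsAnnihilator p) (hR : IsSemiprimeRing R)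
    (hG : IsLeftGoldie R) {s : R} : s ∈ regularModulo p ↔ ∀ x, x * s ∈ p → x ∈ p := by
  refine ⟨fun h => (SetLoc.mem_regularModulo_iff.1 h).2,
    fun hs => SetLoc.mem_regularModulo_iff.2 ⟨fun x hsx => ?_, hs⟩⟩
  obtain ⟨d, hd, e, he, hde⟩ := hp.exists_add_mem_regularElements hR hG
  refine hp.mem_of_forall_mul_eq_zero hR fun u hu =>
    (hp.mul_add_mem_regularElements hR hG hd he hde hs).left.mul_left_eq_zero_iff.1 ?_
  have hsxu : s * x * u = 0 := mul_eq_zero_of_mem_of_mem_leftAnn hR hsx hu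
  have hexu : e * x * u = 0 := mul_eq_zero_of_mem_of_mem_leftAnn hR (p.mul_mem_right e x he) hu
  calc (d * s + e) * (x * u) = d * (s * x * u) + e * x * u := by noncomm_ring
    _ = 0 := by rw [hsxu, hexu, mul_zero, add_zero]

lemma regularElements_subset_regularModulo (hp : IsAnnihilator p) (hR : IsSemiprimeRing R)
    (hG : IsLeftGoldie R) : regularElements R ⊆ regularModulo p := fun c hc =>
  (hp.mem_regularModulo_iff hR hG).2 fun x hx => hp x fun u hu =>
    hc.right.mul_right_eq_zero_iff.1 (by rw [mul_assoc, hu _ hx])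

lemma exists_mem_regularModulo_mem_leftAnn (hp : IsAnnihilator p) (hR : IsSemiprimeRing R)
    (hG : IsLeftGoldie R) : ∃ d ∈ regularModulo p, d ∈ leftAnn (p : Set R) := by
  obtain ⟨d, hd, e, he, hde⟩ := hp.exists_add_mem_regularElements hR hG
  exact ⟨d, (hp.mem_regularModulo_iff hR hG).2 fun x => hp.mem_of_mul_mem he hde, hd⟩

lemma le_of_regularModulo_subset (hp : IsAnnihilator p) (hR : IsSemiprimeRing R)
    (hG : IsLeftGoldie R) {q : TwoSidedIdeal R} (h : regularModulo p ⊆ regularModulo q) :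
    p ≤ q := by
  obtain ⟨d, hd, hdp⟩ := hp.exists_mem_regularModulo_mem_leftAnn hR hG
  intro x hx
  refine (SetLoc.mem_regularModulo_iff.1 (h hd)).1 x ?_
  rw [hdp x hx]
  exact q.zero_mem

/- The Ore condition for `r` and `s` modulo `p` is that of `R` for `r` and the regular element
`d * s + e`, multiplied from the left by `d` to remove the term in `e`. -/
theorem isLeftDenominatorSet_regularModulo (hp : IsAnnihilator p) (hR : IsSemiprimeRing R)
    (hG : IsLeftGoldie R) (hp1 : p ≠ ⊤) : IsLeftDenominatorSet (regularModulo p) := by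
  have hmem {c : R} := hp.mem_regularModulo_iff hR hG (s := c)
  have hmul : ∀ a ∈ regularModulo p, ∀ b ∈ regularModulo p, a * b ∈ regularModulo p := by
    intro a ha b hb
    exact hmem.2 fun x hx => hmem.1 ha x (hmem.1 hb _ (by rwa [mul_assoc]))
  obtain ⟨d, hd, e, he, hde⟩ := hp.exists_add_mem_regularElements hR hG
  have hdp : d ∈ regularModulo p := hmem.2 fun x => hp.mem_of_mul_mem he hde
  refine ⟨⟨⟨hmul, hmem.2 fun x => by rw [mul_one]; exact id, fun h0 => hp1 ?_⟩,
    fun r s hs => ?_⟩, fun r s hs hrs => ?_⟩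
  · exact top_le_iff.1 fun x _ => hmem.1 h0 x (by rw [mul_zero]; exact p.zero_mem)
  · obtain ⟨c, hc, r', hcr⟩ := exists_regular_mul_eq hR hG r
      (hp.mul_add_mem_regularElements hR hG hd he hde (hmem.1 hs))
    refine ⟨d * c, hmul d hdp c (hp.regularElements_subset_regularModulo hR hG hc),
      d * r' * d, ?_⟩
    calc d * c * r = d * r' * d * s + d * r' * e := by rw [mul_assoc, hcr]; noncomm_ring
      _ = d * r' * d * s := by rw [mul_mem_leftAnn hd r' e he, add_zero]
  · exact ⟨d, hdp, hd r (hmem.1 hs r (by rw [hrs]; exact p.zero_mem))⟩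

end IsAnnihilator

end AnnihilatorIdeals

section MinimalPrimes

variable {R : Type v} [Ring R]

/-- The annihilator `{r | r R y = 0}` of the cyclic left module `Ry`. -/
def annIdeal (y : R) : TwoSidedIdeal R :=
  .mk' {r | ∀ t, r * t * y = 0} (fun t => by rw [zero_mul, zero_mul])
    (fun ha hb t => by rw [add_mul, add_mul, ha, hb, add_zero])
    (fun ha t => by rw [neg_mul, neg_mul, ha, neg_zero])
    (fun hb t => by rw [mul_assoc, mul_assoc, ← mul_assoc _ t, hb, mul_zero])
    (fun ha t => by rw [mul_assoc _ _ t, ha])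

lemma mem_annIdeal {y r : R} : r ∈ annIdeal y ↔ ∀ t, r * t * y = 0 :=
  TwoSidedIdeal.mem_mk' ..

lemma mem_annIdeal_comm (hR : IsSemiprimeRing R) {y r : R} :
    r ∈ annIdeal y ↔ y ∈ annIdeal r := by
  simp only [mem_annIdeal]
  exact ⟨hR.mul_mul_eq_zero_swap, hR.mul_mul_eq_zero_swap⟩

lemma notMem_annIdeal_self (hR : IsSemiprimeRing R) {y : R} (hy : y ≠ 0) : y ∉ annIdeal y :=
  fun h => hy (hR y (mem_annIdeal.1 h))

lemma isAnnihilator_annIdeal (hR : IsSemiprimeRing R) (y : R) : IsAnnihilator (annIdeal y) := by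
  intro x hx
  rw [mem_annIdeal_comm hR, mem_annIdeal]
  intro t
  refine hx (y * t) fun r hr => ?_
  exact mem_annIdeal.1 ((mem_annIdeal_comm hR).1 hr) t

/-- The cyclic left module `Ry` is prime: it is nonzero and all its nonzero submodules have the
same annihilator. It suffices to test the cyclic submodules. -/
def IsPrimeCyclic (y : R) : Prop :=
  y ≠ 0 ∧ ∀ t, t * y ≠ 0 → annIdeal (t * y) ≤ annIdeal y

lemma IsLeftGoldie.exists_isPrimeCyclic_mul (hG : IsLeftGoldie R) {z : R} (hz : z ≠ 0) :
    ∃ t, IsPrimeCyclic (t * z) := by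
  have hann : ∀ x r : R, r ∈ leftAnn (Set.range fun t => t * x) ↔ r ∈ annIdeal x := fun x r => by
    simp only [mem_leftAnn, Set.forall_mem_range, mem_annIdeal, mul_assoc]
  obtain ⟨t, ht, hmax⟩ := hG.exists_maximalFor_leftAnn (fun t : R => Set.range fun s => s * (t * z))
    (P := fun t => t * z ≠ 0) ⟨1, by rwa [one_mul]⟩
  refine ⟨t, ht, fun s hs r hr => ?_⟩
  rw [← mul_assoc] at hs hr
  refine (hann _ r).1 (hmax hs (fun r hr => ?_) ((hann _ r).2 hr))
  rw [hann, mem_annIdeal] at hr ⊢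
  intro u
  simpa only [mul_assoc] using hr (u * s)

lemma IsPrimeCyclic.isPrimeIdeal {y : R} (hy : IsPrimeCyclic y) : IsPrimeIdeal (annIdeal y) := by
  refine ⟨fun h => hy.1 ?_, fun a b hab => or_iff_not_imp_right.2 fun hb => ?_⟩
  · have h1 : (1 : R) ∈ annIdeal y := h ▸ trivial
    simpa only [mul_one, one_mul] using mem_annIdeal.1 h1 1
  · obtain ⟨t, ht⟩ : ∃ t, b * t * y ≠ 0 := by
      simpa only [mem_annIdeal, not_forall] using hb
    refine hy.2 (b * t) ht (mem_annIdeal.2 fun s => ?_)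
    simpa only [mul_assoc] using mem_annIdeal.1 (hab s) t

lemma IsPrimeCyclic.mem_minPrimes (hR : IsSemiprimeRing R) {y : R} (hy : IsPrimeCyclic y) :
    annIdeal y ∈ minPrimes R := by
  refine ⟨hy.isPrimeIdeal, fun q hq hle r hr => ?_⟩
  refine (hq.2 r y fun t => ?_).resolve_right fun h => notMem_annIdeal_self hR hy.1 (hle h)
  rw [mem_annIdeal.1 hr]
  exact q.zero_mem

/-- The left ideal of the elements `c` whose annihilator `annIdeal c` is not contained in the prime
ideal `p`. -/
def IsPrimeIdeal.torsion {p : TwoSidedIdeal R} (hp : IsPrimeIdeal p) : Ideal R where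
  carrier := {c | ∃ w ∉ p, w ∈ annIdeal c}
  zero_mem' := by
    obtain ⟨w, hw⟩ : ∃ w, w ∉ p := by
      by_contra! h
      exact hp.1 (top_le_iff.1 fun w _ => h w)
    exact ⟨w, hw, mem_annIdeal.2 fun t => mul_zero _⟩
  add_mem' := by
    rintro a b ⟨v, hv, hva⟩ ⟨w, hw, hwb⟩
    obtain ⟨r, hr⟩ : ∃ r, v * r * w ∉ p := by
      by_contra! h
      exact (hp.2 v w h).elim hv hw
    refine ⟨v * r * w, hr, mem_annIdeal.2 fun t => ?_⟩
    calc v * r * w * t * (a + b) = v * (r * w * t) * a + v * r * (w * t * b) := by noncomm_ring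
      _ = 0 := by rw [mem_annIdeal.1 hva, mem_annIdeal.1 hwb, mul_zero, add_zero]
  smul_mem' := by
    rintro s a ⟨w, hw, hwa⟩
    exact ⟨w, hw, mem_annIdeal.2 fun t => by
      rw [smul_eq_mul, ← mul_assoc, mul_assoc w, mem_annIdeal.1 hwa]⟩

lemma IsPrimeIdeal.not_isEssential_torsion (hR : IsSemiprimeRing R) (hG : IsLeftGoldie R)
    {p : TwoSidedIdeal R} (hp : IsPrimeIdeal p) : ¬ IsEssential hp.torsion := by
  intro hess
  obtain ⟨c, ⟨w, hwp, hwc⟩, hc⟩ := hess.exists_regular hR hG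
  have hw : w = 0 := hc.right.mul_right_eq_zero_iff.1 <| by
    simpa only [mul_one] using mem_annIdeal.1 hwc 1
  exact hwp (hw ▸ p.zero_mem)

lemma exists_isPrimeCyclic_of_not_isEssential (hG : IsLeftGoldie R) {E : Ideal R}
    (hE : ¬ IsEssential E) : ∃ y, IsPrimeCyclic y ∧ ∀ t, t * y ∈ E → t * y = 0 := by
  obtain ⟨z, hz0, hz⟩ : ∃ z ≠ 0, ∀ t, t * z ∈ E → t * z = 0 := by
    simpa only [IsEssential, ne_eq, not_forall, not_exists, not_and', not_not, exists_prop] using hE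
  obtain ⟨t, ht⟩ := hG.exists_isPrimeCyclic_mul hz0
  exact ⟨t * z, ht, fun s => by simpa only [mul_assoc] using hz (s * t)⟩

theorem exists_annIdeal_eq_of_mem_minPrimes (hR : IsSemiprimeRing R) (hG : IsLeftGoldie R)
    {p : TwoSidedIdeal R} (hp : p ∈ minPrimes R) : ∃ y, annIdeal y = p := by
  obtain ⟨y, hy, hyp⟩ :=
    exists_isPrimeCyclic_of_not_isEssential hG (hp.1.not_isEssential_torsion hR hG)
  have hle : annIdeal y ≤ p := by
    intro w hw
    by_contra hwp
    exact hy.1 (by simpa only [one_mul] using hyp 1 (Ideal.mul_mem_left _ 1 ⟨w, hwp, hw⟩))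
  exact ⟨y, le_antisymm hle (hp.2 hy.isPrimeIdeal hle)⟩

lemma isAnnihilator_of_mem_minPrimes (hR : IsSemiprimeRing R) (hG : IsLeftGoldie R)
    {p : TwoSidedIdeal R} (hp : p ∈ minPrimes R) : IsAnnihilator p := by
  obtain ⟨y, rfl⟩ := exists_annIdeal_eq_of_mem_minPrimes hR hG hp
  exact isAnnihilator_annIdeal hR y

theorem exists_subset_regularModulo_of_isUnit (hR : IsSemiprimeRing R) (hG : IsLeftGoldie R)
    {A : Type*} [Ring A] (f : R →+* A) (hf : ∀ c ∈ regularElements R, f c ≠ 0) {S : Set R}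
    (hS : ∀ s ∈ S, IsUnit (f s)) : ∃ p ∈ minPrimes R, S ⊆ regularModulo p := by
  have hker : ¬ IsEssential (RingHom.ker f) := fun hess =>
    have ⟨c, hc, hreg⟩ := hess.exists_regular hR hG
    hf c hreg hc
  obtain ⟨y, hy, hyk⟩ := exists_isPrimeCyclic_of_not_isEssential hG hker
  have hle : ∀ u, f u = 0 → u ∈ annIdeal y := fun u hu => mem_annIdeal.2 fun t =>
    hyk (u * t) (by rw [RingHom.mem_ker, map_mul, map_mul, hu, zero_mul, zero_mul])
  refine ⟨annIdeal y, hy.mem_minPrimes hR, fun s hs => ?_⟩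
  refine ((isAnnihilator_annIdeal hR y).mem_regularModulo_iff hR hG).2 fun x hx => ?_
  refine (hy.isPrimeIdeal.2 y x fun t => hle _ ?_).resolve_left (notMem_annIdeal_self hR hy.1)
  have hyxs : y * t * (x * s) = 0 := mem_annIdeal.1 ((mem_annIdeal_comm hR).1 hx) t
  rw [← (hS s hs).mul_left_eq_zero, ← map_mul, mul_assoc, hyxs, map_zero]

end MinimalPrimes

section Localization

variable {R : Type v} [Ring R]

/-- A multiplicative set as a submonoid. -/
def IsMultiplicativeSet.toSubmonoid {S : Set R} (hS : IsMultiplicativeSet S) : Submonoid R where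
  carrier := S
  mul_mem' {a b} ha hb := hS.mul_mem a ha b hb
  one_mem' := hS.one_mem

lemma IsLeftOreSet.isLeftDenominatorSet (hG : IsLeftGoldie R) {S : Set R} (hS : IsLeftOreSet S) :
    IsLeftDenominatorSet S := by
  refine ⟨hS, fun r s hs hrs => ?_⟩
  have hmono : Monotone fun n => leftAnn {s ^ n} := monotone_nat_of_le_succ fun n => by
    simpa only [pow_succ] using leftAnn_singleton_le_mul (s ^ n) s
  obtain ⟨n, hn⟩ := hG.acc_leftAnn (fun n => {s ^ n}) hmono
  obtain ⟨t, ht, r', h⟩ := hS.left_ore r (s ^ n) (hS.toSubmonoid.pow_mem hs n)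
  have hr' : r' ∈ leftAnn {s ^ (n + 1)} := mem_leftAnn_singleton.2 <| by
    rw [pow_succ, ← mul_assoc, ← h, mul_assoc, hrs, mul_zero]
  rw [hn (n + 1) n.le_succ] at hr'
  exact ⟨t, ht, h.trans (mem_leftAnn_singleton.1 hr')⟩

variable (K : Type u) [CommRing K] [Algebra K R]

theorem IsLeftDenominatorSet.exists_algHom {S : Set R} (hS : IsLeftDenominatorSet S) :
    ∃ (A : Type v) (_ : Ring A) (_ : Algebra K A) (f : R →ₐ[K] A),
      (∀ s ∈ S, IsUnit (f s)) ∧ ∀ r, f r = 0 → ∃ s ∈ S, s * r = 0 := by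
  let M := hS.toSubmonoid
  have hM : Nonempty (OreLocalization.OreSet M) := by
    refine OreLocalization.nonempty_oreSet_iff.2 ⟨fun a b s h => ?_, fun r s => ?_⟩
    · obtain ⟨t, ht, hab⟩ :=
        hS.left_cancel (a - b) s s.2 (by rw [sub_mul, h, sub_self])
      exact ⟨⟨t, ht⟩, by rwa [mul_sub, sub_eq_zero] at hab⟩
    · obtain ⟨s', hs', r', h⟩ := hS.left_ore r s s.2
      exact ⟨r', ⟨s', hs'⟩, h⟩
  obtain ⟨_⟩ := hM
  refine ⟨OreLocalization M R, inferInstance, inferInstance,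
    { OreLocalization.numeratorRingHom with commutes' := fun _ => rfl },
    fun s hs => OreLocalization.numerator_isUnit (⟨s, hs⟩ : M), fun r hr => ?_⟩
  have hr : r /ₒ (1 : M) = 0 := hr
  rw [OreLocalization.zero_def, OreLocalization.oreDiv_eq_iff] at hr
  obtain ⟨u, v, h, h'⟩ := hr
  simp only [Submonoid.smul_def, smul_eq_mul, mul_zero, OneMemClass.coe_one, mul_one] at h h'
  exact ⟨u, u.2, by rw [h', ← h]⟩

lemma IsLeftDenominatorSet.exists_subset_regularModulo (hR : IsSemiprimeRing R)
    (hG : IsLeftGoldie R) {S : Set R} (hS : IsLeftDenominatorSet S) :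
    ∃ p ∈ minPrimes R, S ⊆ regularModulo p := by
  obtain ⟨A, _, _, f, hf, hker⟩ := hS.exists_algHom ℤ
  refine exists_subset_regularModulo_of_isUnit hR hG (f : R →+* A) (fun c hc hfc => ?_) hf
  obtain ⟨s, hs, hsc⟩ := hker c hfc
  exact hS.zero_notMem (hc.right.mul_right_eq_zero_iff.1 hsc ▸ hs)

variable (S : Set R)

/-- `FreeExt.of` as a homomorphism of algebras. -/
noncomputable def FreeExt.ofAlgHom : R →ₐ[K] FreeExt K S :=
  have commutes (k : K) : FreeExt.of K S (algebraMap K R k) = algebraMap K (FreeExt K S) k :=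
    (RingQuot.mkAlgHom_rel K (FreeExtRel.scalar k)).trans (AlgHom.commutes _ k)
  { toFun := FreeExt.of K S
    map_one' := by simpa only [map_one] using commutes 1
    map_mul' a b := (RingQuot.mkAlgHom_rel K (FreeExtRel.mul a b)).trans (map_mul _ _ _)
    map_zero' := by simpa only [map_zero] using commutes 0
    map_add' a b := (RingQuot.mkAlgHom_rel K (FreeExtRel.add a b)).trans (map_add _ _ _)
    commutes' := commutes }

/-- The canonical map `R → R⟨S⁻¹⟩`. -/
noncomputable def toSetLocalization : R →ₐ[K] SetLocalization K S :=
  (RingQuot.mkAlgHom K (InvRel K S)).comp (FreeExt.ofAlgHom K S)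

variable {S}

lemma isUnit_toSetLocalization {s : R} (hs : s ∈ S) : IsUnit (toSetLocalization K S s) := by
  have hright := RingQuot.mkAlgHom_rel K (InvRel.right_inv (K := K) (⟨s, hs⟩ : S))
  have hleft := RingQuot.mkAlgHom_rel K (InvRel.left_inv (K := K) (⟨s, hs⟩ : S))
  rw [map_mul, map_one] at hright hleft
  exact ⟨⟨_, _, hright, hleft⟩, rfl⟩

variable {K}
variable {A : Type*} [Ring A] [Algebra K A] (f : R →ₐ[K] A)

/-- The homomorphism `R⟨X_S⟩ → A` that extends `f : R → A` and sends `x_s` to `g s`. -/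
noncomputable def FreeExt.lift (g : S → A) : FreeExt K S →ₐ[K] A :=
  RingQuot.liftAlgHom K ⟨FreeAlgebra.lift K (Sum.elim f g), by
    rintro _ _ (⟨a, b⟩ | ⟨a, b⟩ | k)
    · simp only [map_add, FreeAlgebra.lift_ι_apply, Sum.elim_inl]
    · simp only [map_mul, FreeAlgebra.lift_ι_apply, Sum.elim_inl]
    · simp only [FreeAlgebra.lift_ι_apply, Sum.elim_inl, AlgHom.commutes]⟩

lemma FreeExt.lift_of (g : S → A) (r : R) : FreeExt.lift f g (FreeExt.of K S r) = f r := by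
  simp only [FreeExt.lift, FreeExt.of, RingQuot.liftAlgHom_mkAlgHom_apply,
    FreeAlgebra.lift_ι_apply, Sum.elim_inl]

lemma FreeExt.lift_x (g : S → A) (s : S) : FreeExt.lift f g (FreeExt.x K S s) = g s := by
  simp only [FreeExt.lift, FreeExt.x, RingQuot.liftAlgHom_mkAlgHom_apply,
    FreeAlgebra.lift_ι_apply, Sum.elim_inr]

/-- The homomorphism `R⟨S⁻¹⟩ → A` induced by a homomorphism `R → A` that inverts `S`. -/
noncomputable def SetLocalization.lift (hf : ∀ s ∈ S, IsUnit (f s)) : SetLocalization K S →ₐ[K] A :=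
  RingQuot.liftAlgHom K ⟨FreeExt.lift f fun s => ↑(hf s s.2).unit⁻¹, by
    rintro _ _ (s | s)
    · simp only [map_mul, FreeExt.lift_of, FreeExt.lift_x, map_one, IsUnit.mul_val_inv]
    · simp only [map_mul, FreeExt.lift_of, FreeExt.lift_x, map_one, IsUnit.val_inv_mul]⟩

lemma isLocalizable_of_isUnit [Nontrivial A] (hf : ∀ s ∈ S, IsUnit (f s)) : IsLocalizable K S :=
  (SetLocalization.lift f hf).toRingHom.domain_nontrivial

variable (K) in
lemma IsLeftDenominatorSet.isLocalizable (hS : IsLeftDenominatorSet S) : IsLocalizable K S := by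
  obtain ⟨A, _, _, f, hf, hker⟩ := hS.exists_algHom K
  have hf1 : f 1 ≠ 0 := fun h => by
    obtain ⟨s, hs, hs1⟩ := hker 1 h
    rw [mul_one] at hs1
    exact hS.zero_notMem (hs1 ▸ hs)
  have : Nontrivial A := nontrivial_of_ne _ _ hf1
  exact isLocalizable_of_isUnit f hf

lemma IsLocalizable.exists_subset_regularModulo (hR : IsSemiprimeRing R) (hG : IsLeftGoldie R)
    (hS : IsLocalizable K S) (hreg : regularElements R ⊆ S) :
    ∃ p ∈ minPrimes R, S ⊆ regularModulo p := by
  have : Nontrivial (SetLocalization K S) := hS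
  have hunit (s : R) (hs : s ∈ S) := isUnit_toSetLocalization K hs
  exact exists_subset_regularModulo_of_isUnit (A := SetLocalization K S) hR hG
    (toSetLocalization K S) (fun c hc => (hunit c (hreg hc)).ne_zero) hunit

end Localization

section Opposite

variable {R : Type v} [Ring R]

open MulOpposite

lemma IsSemiprimeRing.op (hR : IsSemiprimeRing R) : IsSemiprimeRing Rᵐᵒᵖ := fun a h =>
  unop_injective <| hR a.unop fun r => by
    simpa only [unop_mul, unop_op, unop_zero, mul_assoc] using congrArg unop (h (.op r))

lemma IsAnnihilator.op (hR : IsSemiprimeRing R) {p : TwoSidedIdeal R} (hp : IsAnnihilator p) :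
    IsAnnihilator p.op := fun _ hx =>
  TwoSidedIdeal.mem_op_iff.2 <| hp.mem_of_forall_mul_eq_zero hR fun u hu =>
    congrArg unop <| hx (.op u) fun _ hy => unop_injective <|
      mul_eq_zero_of_mem_of_mem_leftAnn hR (TwoSidedIdeal.mem_op_iff.1 hy) hu

lemma regularModulo_op (p : TwoSidedIdeal R) : regularModulo p.op = unop ⁻¹' regularModulo p := by
  ext c
  simp only [Set.mem_preimage, mem_regularModulo_iff, TwoSidedIdeal.mem_op_iff,
    MulOpposite.forall, unop_mul, unop_op]
  exact and_comm

lemma isRightDenominatorSet_of_unop_preimage {S : Set R}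
    (hS : IsLeftDenominatorSet (unop ⁻¹' S)) : IsRightDenominatorSet S where
  mul_mem a ha b hb := hS.mul_mem (.op b) hb (.op a) ha
  one_mem := hS.one_mem
  zero_notMem := hS.zero_notMem
  right_ore r s hs := by
    obtain ⟨s', hs', r', h⟩ := hS.left_ore (.op r) (.op s) hs
    exact ⟨s'.unop, hs', r'.unop, congrArg unop h⟩
  right_cancel r s hs h := by
    obtain ⟨t, ht, h'⟩ := hS.left_cancel (.op r) (.op s) hs (congrArg MulOpposite.op h)
    exact ⟨t.unop, ht, congrArg unop h'⟩

theorem IsAnnihilator.isRightDenominatorSet_regularModulo {p : TwoSidedIdeal R}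
    (hp : IsAnnihilator p) (hR : IsSemiprimeRing R) (hG : IsRightGoldie R) (hp1 : p ≠ ⊤) :
    IsRightDenominatorSet (regularModulo p) := by
  have hop1 : p.op ≠ ⊤ := mt (map_eq_top_iff TwoSidedIdeal.opOrderIso).1 hp1
  refine isRightDenominatorSet_of_unop_preimage ?_
  rw [← regularModulo_op]
  exact (hp.op hR).isLeftDenominatorSet_regularModulo hR.op hG hop1

end Opposite

section MaximalElements

variable {α : Type*} [PartialOrder α] {P : α → Prop} {A : Set α}

lemma setOf_maximal_eq (hA : IsAntichain (· ≤ ·) A) (hPA : ∀ a ∈ A, P a)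
    (hle : ∀ x, P x → ∃ a ∈ A, x ≤ a) : {x | Maximal P x} = A := by
  ext x
  refine ⟨fun hx => ?_, fun hx => ⟨hPA x hx, fun y hy hxy => ?_⟩⟩
  · obtain ⟨a, ha, hxa⟩ := hle x hx.1
    rwa [hx.eq_of_le (hPA a ha) hxa]
  · obtain ⟨a, ha, hya⟩ := hle y hy
    rwa [hA.eq hx ha (hxy.trans hya)]

lemma setOf_maximal_and_le_eq {c : α} (hA : IsAntichain (· ≤ ·) A) (hPA : ∀ a ∈ A, P a)
    (hcA : ∀ a ∈ A, c ≤ a) (hle : ∀ x, P x → c ≤ x → ∃ a ∈ A, x ≤ a) :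
    {x | Maximal P x ∧ c ≤ x} = A := by
  rw [← setOf_maximal_eq (P := fun x => P x ∧ c ≤ x) hA (fun a ha => ⟨hPA a ha, hcA a ha⟩)
    fun x hx => hle x hx.1 hx.2]
  ext x
  exact ⟨fun h => ⟨⟨h.1.1, h.2⟩, fun y hy => h.1.2 hy.1⟩,
    fun h => ⟨⟨h.1.1, fun y hy hxy => h.2 ⟨hy, h.1.2.trans hxy⟩ hxy⟩, h.1.2⟩⟩

end MaximalElements

section MaximalSets

variable {R : Type v} [Ring R] {P : Set R → Prop}

lemma isAntichain_regularModulo (hR : IsSemiprimeRing R) (hG : IsLeftGoldie R) :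
    IsAntichain (· ≤ ·) {S : Set R | ∃ p ∈ minPrimes R, S = regularModulo p} := by
  rintro _ ⟨p, hp, rfl⟩ _ ⟨q, hq, rfl⟩ hne hle
  have hpq : p ≤ q :=
    (isAnnihilator_of_mem_minPrimes hR hG hp).le_of_regularModulo_subset hR hG hle
  exact hne (congrArg _ (hq.eq_of_le hp.1 hpq))

theorem setOf_maximal_and_regularElements_subset_eq {K : Type u} [CommRing K] [Algebra K R]
    (hR : IsSemiprimeRing R) (hG : IsLeftGoldie R) (hP : ∀ p ∈ minPrimes R, P (regularModulo p))
    (hloc : ∀ S, P S → IsLocalizable K S) :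
    {S : Set R | Maximal P S ∧ regularElements R ⊆ S} =
      {S : Set R | ∃ p ∈ minPrimes R, S = regularModulo p} := by
  refine setOf_maximal_and_le_eq (isAntichain_regularModulo hR hG) ?_ ?_ fun S hS hreg => ?_
  · rintro _ ⟨p, hp, rfl⟩
    exact hP p hp
  · rintro _ ⟨p, hp, rfl⟩
    exact (isAnnihilator_of_mem_minPrimes hR hG hp).regularElements_subset_regularModulo hR hG
  · obtain ⟨p, hp, hSp⟩ := (hloc S hS).exists_subset_regularModulo hR hG hreg
    exact ⟨_, ⟨p, hp, rfl⟩, hSp⟩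

theorem setOf_maximal_eq_regularModulo (hR : IsSemiprimeRing R) (hG : IsLeftGoldie R)
    (hP : ∀ p ∈ minPrimes R, P (regularModulo p)) (hden : ∀ S, P S → IsLeftDenominatorSet S) :
    {S : Set R | Maximal P S} = {S : Set R | ∃ p ∈ minPrimes R, S = regularModulo p} := by
  refine setOf_maximal_eq (isAntichain_regularModulo hR hG) ?_ fun S hS => ?_
  · rintro _ ⟨p, hp, rfl⟩
    exact hP p hp
  · obtain ⟨p, hp, hSp⟩ := (hden S hS).exists_subset_regularModulo hR hG
    exact ⟨_, ⟨p, hp, rfl⟩, hSp⟩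

lemma isLeftDenominatorSet_regularModulo (hR : IsSemiprimeRing R) (hG : IsLeftGoldie R)
    {p : TwoSidedIdeal R} (hp : p ∈ minPrimes R) : IsLeftDenominatorSet (regularModulo p) :=
  (isAnnihilator_of_mem_minPrimes hR hG hp).isLeftDenominatorSet_regularModulo hR hG hp.1.1

lemma isDenominatorSet_regularModulo (hR : IsSemiprimeRing R) (hG : IsGoldie R)
    {p : TwoSidedIdeal R} (hp : p ∈ minPrimes R) : IsDenominatorSet (regularModulo p) :=
  ⟨isLeftDenominatorSet_regularModulo hR hG.1 hp,
    (isAnnihilator_of_mem_minPrimes hR hG.1 hp).isRightDenominatorSet_regularModulo hR hG.2 hp.1.1⟩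

lemma IsDenominatorSet.isOreSet {S : Set R} (hS : IsDenominatorSet S) : IsOreSet S :=
  ⟨hS.1.toIsLeftOreSet, hS.2.toIsRightOreSet⟩

end MaximalSets

end SetLoc

theorem mainTheorem8 {K : Type*} {R : Type*} [CommRing K] [Ring R] [Algebra K R]
    (hR : SetLoc.IsSemiprimeRing R) :
    -- semiprime left Goldie rings
    (SetLoc.IsLeftGoldie R →
      {S : Set R | Maximal (SetLoc.IsLocalizable K) S ∧ SetLoc.regularElements R ⊆ S} =
          {S : Set R | Maximal SetLoc.IsLeftDenominatorSet S} ∧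
      {S : Set R | Maximal SetLoc.IsLeftDenominatorSet S} =
          {S : Set R | ∃ p ∈ SetLoc.minPrimes R, S = SetLoc.regularModulo p}) ∧
    -- semiprime (left and right) Goldie rings
    (SetLoc.IsGoldie R →
      {S : Set R | Maximal (SetLoc.IsLocalizable K) S ∧ SetLoc.regularElements R ⊆ S} =
          {S : Set R | Maximal SetLoc.IsOreSet S} ∧
      {S : Set R | Maximal SetLoc.IsOreSet S} = {S : Set R | Maximal SetLoc.IsDenominatorSet S} ∧
      {S : Set R | Maximal SetLoc.IsDenominatorSet S} =
          {S : Set R | ∃ p ∈ SetLoc.minPrimes R, S = SetLoc.regularModulo p} ∧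
      {S : Set R | ∃ p ∈ SetLoc.minPrimes R, S = SetLoc.regularModulo p} =
          {S : Set R | Maximal (fun T : Set R => SetLoc.IsLocalizable K T ∧ SetLoc.IsLeftOreSet T) S
            ∧ SetLoc.regularElements R ⊆ S} ∧
      {S : Set R | ∃ p ∈ SetLoc.minPrimes R, S = SetLoc.regularModulo p} =
          {S : Set R | Maximal (fun T : Set R => SetLoc.IsLocalizable K T ∧ SetLoc.IsRightOreSet T) S
            ∧ SetLoc.regularElements R ⊆ S} ∧
      {S : Set R | ∃ p ∈ SetLoc.minPrimes R, S = SetLoc.regularModulo p} =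
          {S : Set R | Maximal (fun T : Set R => SetLoc.IsLocalizable K T ∧ SetLoc.IsOreSet T) S
            ∧ SetLoc.regularElements R ⊆ S}) := by
  refine ⟨fun hG => ?_, fun hG => ?_⟩
  · have hden := fun p hp => SetLoc.isLeftDenominatorSet_regularModulo hR hG (p := p) hp
    rw [SetLoc.setOf_maximal_and_regularElements_subset_eq hR hG
        (fun p hp => (hden p hp).isLocalizable K) fun _ => id,
      SetLoc.setOf_maximal_eq_regularModulo hR hG hden fun _ => id]
    exact ⟨rfl, rfl⟩
  · have hden := fun p hp => SetLoc.isDenominatorSet_regularModulo hR hG (p := p) hp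
    have hore := fun p hp => (hden p hp).isOreSet
    have hloc := fun p hp => (hden p hp).1.isLocalizable K
    rw [SetLoc.setOf_maximal_and_regularElements_subset_eq hR hG.1 hloc fun _ => id,
      SetLoc.setOf_maximal_eq_regularModulo hR hG.1 hore fun _ h => h.1.isLeftDenominatorSet hG.1,
      SetLoc.setOf_maximal_eq_regularModulo hR hG.1 hden fun _ h => h.1,
      SetLoc.setOf_maximal_and_regularElements_subset_eq hR hG.1
        (fun p hp => ⟨hloc p hp, (hore p hp).1⟩) fun _ h => h.1,
      SetLoc.setOf_maximal_and_regularElements_subset_eq hR hG.1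
        (fun p hp => ⟨hloc p hp, (hore p hp).2⟩) fun _ h => h.1,
      SetLoc.setOf_maximal_and_regularElements_subset_eq hR hG.1
        (fun p hp => ⟨hloc p hp, hore p hp⟩) fun _ h => h.1]
    exact ⟨rfl, rfl, rfl, rfl, rfl, rfl⟩
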